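/- Let $\omega_1$ carry the order topology and let $L$ be a locally compact Hausdorff space equipped with a continuous surjection $\varphi:L\to\omega_1$ all of whose fibres are finite; put $L_\alpha=\{x\in L:\varphi(x)<\alpha\}$ for $\alpha<\omega_1$, and let $K=L\cup\{\infty\}$ be the one-point compactification of $L$. For $m\ge 1$ and a partition $\{I_1,\dots,I_k\}$ of $\{1,\dots,m\}$ into nonempty sets, a set $\mathcal C\subset L^m$ is called $(I_1,\dots,I_k)$-separated if, writing $G_j(x)=\{x_i:i\in I_j\}$ for $x=(x_1,\dots,x_m)\in\mathcal C$, the cardinality of $G_j(x)$ depends only on $j$, and $G_i(x)\cap G_j(y)=\emptyset$ for all $x,y\in\mathcal C$ and all $i,j$ such that $i\ne j$ or $x\neq y$. Assume that $L$ has the collapsing property: for every $m\ge1$ and every such partition, every uncountable $(I_1,\dots,I_k)$-separated set $\mathcal C\subset L^m$ has an accumulation point $(q_1,\dots,q_m)\in K^m$ for which there are pairwise distinct points $a_1,\dots,a_k\in K$ with $a_k=\infty$ and $\{q_i:i\in I_j\}=\{a_j\}$ for $1\le j\le k$. Let all function spaces be real, let $I$ be the identity of $C_0(L\times L)$, let $J(f)(x,y)=f(y,x)$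 for $f\in C_0(L\times L)$, and let $P_1=\frac12(I+J)$ and $P_2=\frac12(I-J)$ be the projections onto the symmetric and the antisymmetric functions. Let $X$ be a real normed space that is linearly homeomorphic to $C_0(L\times L)$, to $P_1[C_0(L\times L)]$, or to $P_2[C_0(L\times L)]$ (so $X$ may be one of these three spaces, and also any space $C_0(\Omega_i)$ isometrically isomorphic to $P_i[C_0(L\times L)]$, $i\in\{1,2\}$). Then for every $\alpha<\omega_1$ there is no injective bounded linear operator from $X$ into $C_0(L_\alpha\times L)$. Consequently $X$ does not embed into $C_0(\omega^\omega\times L)$, that is, $X$ is not linearly homeomorphic to any linear subspace of $C_0(\omega^\omega\times L)$, where $\omega^\omega$ is the ordinal power, with its order topology. -/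

import Mathlib

open scoped ZeroAtInfty Ordinal

/-- `φ : L → ω₁` is a finite-to-one continuous surjection onto the space of countable ordinals with
its order topology (`Set.Iio (ω_ 1)` is an initial segment, so its order topology is the subspace
topology inherited from the ordinals). A locally compact Hausdorff space belongs to the class `𝒮` if
it carries such a map. -/
structure IsFiniteToOneOntoOmegaOne {L : Type*} [TopologicalSpace L] (φ : L → Ordinal.{0}) :
    Prop where
  continuous : Continuous φ
  range_eq : Set.range φ = Set.Iio (ω_ 1)
  finite_fiber : ∀ α < ω_ 1, (φ ⁻¹' {α}).Finite

/-- `L_α = φ⁻¹[α] = {x ∈ L : φ x < α}`. -/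
def initialPart {L : Type*} (φ : L → Ordinal.{0}) (α : Ordinal.{0}) : Set L :=
  {x | φ x < α}

/-- The set `{x_i : i ∈ I_j}` of coordinates of `x` in the block `I_j = p⁻¹{j}` of the labelled
partition of the index set given by `p`. -/
def block {L : Type*} {m k : ℕ} (p : Fin m → Fin k) (x : Fin m → L) (j : Fin k) : Set L :=
  x '' (p ⁻¹' {j})

/-- A set `C ⊆ L^m` is `(I_1, …, I_k)`-separated, for the labelled partition `I_j = p⁻¹{j}`: the
blocks with label `j` all have the same finite nonzero number of elements, and blocks with distinct
labels or coming from distinct members of `C` are disjoint. -/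
def IsSeparated {L : Type*} {m k : ℕ} (p : Fin m → Fin k) (C : Set (Fin m → L)) : Prop :=
  (∃ s : Fin k → ℕ, ∀ j, s j ≠ 0 ∧ ∀ x ∈ C, (block p x j).ncard = s j) ∧
    ∀ x ∈ C, ∀ y ∈ C, ∀ i j : Fin k, (i ≠ j ∨ x ≠ y) → Disjoint (block p x i) (block p y j)

/-- `C ⊆ L^m` collapses, for a labelled partition into `k + 1` blocks: regarded as a subset of
`K^m`, with `K = L ∪ {∞}` the one-point compactification, it has an accumulation point `q` which is
constant on each block, with pairwise distinct values `a_1, …, a_{k+1}` on the blocks, the value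
`a_{k+1}` on the last block being `∞`. -/
def Collapses {L : Type*} [TopologicalSpace L] {m k : ℕ} (p : Fin m → Fin (k + 1))
    (C : Set (Fin m → L)) : Prop :=
  ∃ q : Fin m → OnePoint L,
    AccPt q (Filter.principal ((fun (x : Fin m → L) (i : Fin m) => (x i : OnePoint L)) '' C)) ∧
    ∃ a : Fin (k + 1) → OnePoint L, Function.Injective a ∧ a (Fin.last k) = OnePoint.infty ∧
      ∀ i, q i = a (p i)

/-- The collapsing property: for every `m ≥ 1` and every partition of the `m` indices into finitely
many nonempty labelled blocks (a surjection `p` onto the labels), every uncountable separated subset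
of `L^m` collapses. -/
def CollapsingProperty (L : Type*) [TopologicalSpace L] : Prop :=
  ∀ (m k : ℕ), 1 ≤ m → ∀ p : Fin m → Fin (k + 1), Function.Surjective p →
    ∀ C : Set (Fin m → L), ¬ C.Countable → IsSeparated p C → Collapses p C

noncomputable section

/-- The operator `J` on `C₀(L × L)`, `J f (x, y) = f (y, x)`. -/
def transposeOp (L : Type*) [TopologicalSpace L] : C₀(L × L, ℝ) →L[ℝ] C₀(L × L, ℝ) :=
  LinearMap.mkContinuous
    (ZeroAtInftyContinuousMap.compLinearMap (R := ℝ)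
      (⟨⟨Prod.swap, continuous_swap⟩,
        (Homeomorph.prodComm L L).isClosedEmbedding.tendsto_cocompact⟩ :
        CocompactMap (L × L) (L × L))) 1 (by
    intro f
    rw [one_mul, ← ZeroAtInftyContinuousMap.norm_toBCF_eq_norm,
      BoundedContinuousFunction.norm_le (norm_nonneg f)]
    intro x
    rw [← ZeroAtInftyContinuousMap.norm_toBCF_eq_norm]
    exact f.toBCF.norm_coe_le_norm x.swap)

theorem transposeOp_apply {L : Type*} [TopologicalSpace L] (f : C₀(L × L, ℝ)) (x y : L) :
    transposeOp L f (x, y) = f (y, x) := rfl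

/-- `P₁ = (I + J) / 2`, the natural projection of `C₀(L × L)` onto the symmetric functions. -/
def symmProj (L : Type*) [TopologicalSpace L] : C₀(L × L, ℝ) →L[ℝ] C₀(L × L, ℝ) :=
  (1 / 2 : ℝ) • (ContinuousLinearMap.id ℝ C₀(L × L, ℝ) + transposeOp L)

/-- `P₂ = (I - J) / 2`, the natural projection of `C₀(L × L)` onto the antisymmetric functions. -/
def antisymmProj (L : Type*) [TopologicalSpace L] : C₀(L × L, ℝ) →L[ℝ] C₀(L × L, ℝ) :=
  (1 / 2 : ℝ) • (ContinuousLinearMap.id ℝ C₀(L × L, ℝ) - transposeOp L)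

end

/-! Compact subsets of `L` and `L × L` are countable, so a bounded functional on `C₀(L × L)` is
determined, up to a small error, by the values at finitely many points. In particular, it kills
functions supported beyond some countable ordinal.

The heart is `exists_forall_rectangleIndicator_eq_zero`: an operator `T` into `C₀(L)` kills the
indicators of all rectangles `U × V` with disjoint sides beyond some countable ordinal. Otherwise
finite tuples witnessing `|T 1_{U×V} (x i₀)| > ε` exist arbitrarily far out. By pigeonhole and a
Δ-system argument they have one combinatorial type, and the coordinates outside a bounded root
escape. Collapsing is applied to pairs `(x, y)` of witnesses: the non-root coordinates of `x` tend
to `a`, `b` or `∞` according to membership in `U`, in `V` or in neither, `y i₀` tends to the limit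
of `x i₀`, and the other non-root coordinates of `y` tend to `∞`. Let `f` be the indicator of a
small rectangle around `(a, b)`. It agrees with `1_{U×V}` on the pairs from `x` and vanishes on the
pairs from `y`, so `T f` is large at `x i₀` and small at `y i₀`, against its continuity on the
one-point compactification.

For countable `M`, an operator into `C₀(M × L)` is a countable family of operators into `C₀(L)`, so
it kills a common rectangle indicator. The symmetric and antisymmetric parts of this indicator are
nonzero, which excludes injectivity on all three spaces. -/

section FunctionsVanishingAtInfinity

open Filter Topology

variable {S : Type*} [TopologicalSpace S]

/-! ### Functions vanishing at infinity, clopen cuts and indicators -/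

theorem ZeroAtInftyContinuousMap.abs_apply_le_norm (f : C₀(S, ℝ)) (x : S) : |f x| ≤ ‖f‖ := by
  rw [← ZeroAtInftyContinuousMap.norm_toBCF_eq_norm]
  exact f.toBCF.norm_coe_le_norm x

theorem ZeroAtInftyContinuousMap.norm_le_of_forall_abs_le {f : C₀(S, ℝ)} {C : ℝ} (hC : 0 ≤ C)
    (h : ∀ x, |f x| ≤ C) : ‖f‖ ≤ C := by
  rw [← ZeroAtInftyContinuousMap.norm_toBCF_eq_norm, BoundedContinuousFunction.norm_le hC]
  exact h

/-- Off a compact set, a function vanishing at infinity is small. -/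
theorem ZeroAtInftyContinuousMap.exists_isCompact_abs_lt (f : C₀(S, ℝ)) {ε : ℝ} (hε : 0 < ε) :
    ∃ K : Set S, IsCompact K ∧ ∀ x ∉ K, |f x| < ε := by
  have h := (Metric.tendsto_nhds.1 f.zero_at_infty') ε hε
  obtain ⟨K, hK, hKf⟩ := Filter.mem_cocompact.1 h
  refine ⟨K, hK, fun x hx => ?_⟩
  simpa [Real.dist_eq] using hKf hx

/-- The product of a function vanishing at infinity with the indicator of a clopen set. -/
noncomputable def clopenCut (W : Set S) (hW : IsClopen W) (f : C₀(S, ℝ)) : C₀(S, ℝ) where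
  toFun := W.indicator f
  continuous_toFun := hW.continuous_indicator (map_continuous f)
  zero_at_infty' := by
    refine squeeze_zero_norm (fun x => norm_indicator_le_norm_self (f : S → ℝ) x) ?_
    simpa [Function.comp_def] using tendsto_norm_zero.comp f.zero_at_infty'

theorem clopenCut_of_mem {W : Set S} (hW : IsClopen W) (f : C₀(S, ℝ)) {x : S} (hx : x ∈ W) :
    clopenCut W hW f x = f x := Set.indicator_of_mem hx f

theorem clopenCut_of_notMem {W : Set S} (hW : IsClopen W) (f : C₀(S, ℝ)) {x : S} (hx : x ∉ W) :
    clopenCut W hW f x = 0 := Set.indicator_of_notMem hx f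

theorem clopenCut_apply_eq_zero {W : Set S} (hW : IsClopen W) {f : C₀(S, ℝ)} {x : S}
    (hx : f x = 0) : clopenCut W hW f x = 0 := by
  by_cases h : x ∈ W
  · rw [clopenCut_of_mem hW f h, hx]
  · exact clopenCut_of_notMem hW f h

theorem norm_clopenCut_le {W : Set S} (hW : IsClopen W) (f : C₀(S, ℝ)) :
    ‖clopenCut W hW f‖ ≤ ‖f‖ := by
  refine ZeroAtInftyContinuousMap.norm_le_of_forall_abs_le (norm_nonneg f) fun x => ?_
  by_cases h : x ∈ W
  · rw [clopenCut_of_mem hW f h]; exact f.abs_apply_le_norm x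
  · rw [clopenCut_of_notMem hW f h, abs_zero]; exact norm_nonneg f

theorem clopenCut_add_clopenCut_compl {W : Set S} (hW : IsClopen W) (f : C₀(S, ℝ)) :
    clopenCut W hW f + clopenCut Wᶜ hW.compl f = f := by
  ext x
  exact Set.indicator_self_add_compl_apply W f x

/-- The indicator function of a compact clopen set. -/
noncomputable def compactIndicator (W : Set S) (hW : IsClopen W) (hc : IsCompact W) :
    C₀(S, ℝ) where
  toFun := W.indicator 1
  continuous_toFun := hW.continuous_indicator continuous_one
  zero_at_infty' := by
    refine tendsto_nhds_of_eventually_eq ?_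
    filter_upwards [hc.compl_mem_cocompact] with x hx
    exact Set.indicator_of_notMem hx _

theorem compactIndicator_of_mem {W : Set S} (hW : IsClopen W) (hc : IsCompact W) {x : S}
    (hx : x ∈ W) : compactIndicator W hW hc x = 1 := Set.indicator_of_mem hx _

theorem compactIndicator_of_notMem {W : Set S} (hW : IsClopen W) (hc : IsCompact W) {x : S}
    (hx : x ∉ W) : compactIndicator W hW hc x = 0 := Set.indicator_of_notMem hx _

theorem norm_compactIndicator_le {W : Set S} (hW : IsClopen W) (hc : IsCompact W) :
    ‖compactIndicator W hW hc‖ ≤ 1 := by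
  refine ZeroAtInftyContinuousMap.norm_le_of_forall_abs_le zero_le_one fun x => ?_
  by_cases h : x ∈ W
  · simp [compactIndicator_of_mem hW hc h]
  · simp [compactIndicator_of_notMem hW hc h]

theorem norm_compactIndicator_sub_le {V W : Set S} (hV : IsClopen V) (hVc : IsCompact V)
    (hW : IsClopen W) (hWc : IsCompact W) :
    ‖compactIndicator V hV hVc - compactIndicator W hW hWc‖ ≤ 1 := by
  refine ZeroAtInftyContinuousMap.norm_le_of_forall_abs_le zero_le_one fun x => ?_
  rw [ZeroAtInftyContinuousMap.sub_apply]
  by_cases h : x ∈ V <;> by_cases h' : x ∈ W <;>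
    simp [compactIndicator_of_mem, compactIndicator_of_notMem, h, h']

/-- The evaluation functional at a point. -/
noncomputable def evalFunctional (x : S) : C₀(S, ℝ) →L[ℝ] ℝ :=
  LinearMap.mkContinuous { toFun := fun f => f x, map_add' := fun _ _ => rfl,
                           map_smul' := fun _ _ => rfl } 1 fun f => by
    rw [one_mul]; exact f.abs_apply_le_norm x

/-- The composition of functions vanishing at infinity with a closed embedding. -/
noncomputable def restrictOp {R : Type*} [TopologicalSpace R] (e : R → S)
    (he : IsClosedEmbedding e) : C₀(S, ℝ) →L[ℝ] C₀(R, ℝ) :=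
  LinearMap.mkContinuous
    (ZeroAtInftyContinuousMap.compLinearMap (R := ℝ)
      (⟨⟨e, he.continuous⟩, he.tendsto_cocompact⟩ : CocompactMap R S)) 1 fun f => by
    rw [one_mul]
    exact ZeroAtInftyContinuousMap.norm_le_of_forall_abs_le (norm_nonneg f) fun x =>
      f.abs_apply_le_norm (e x)

/-! ### Bounded functionals up to small errors -/

/-- Let `E` be a space of functions which is stable under multiplication by indicators of clopen
sets, and each of whose members is small on some member of the family `𝒲` of clopen sets. Then a
bounded functional is small on the functions of `E` supported by a suitable member of `𝒲`. -/
theorem exists_abs_le_of_support_subset (ψ : C₀(S, ℝ) →L[ℝ] ℝ) (E : Submodule ℝ C₀(S, ℝ))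
    (hE : ∀ W (hW : IsClopen W), ∀ f ∈ E, clopenCut W hW f ∈ E) (𝒲 : Set (Set S))
    (h𝒲 : ∀ W ∈ 𝒲, IsClopen W)
    (hsmall : ∀ f ∈ E, ∀ ε > 0, ∃ W ∈ 𝒲, ∀ x ∈ W, |f x| ≤ ε) {δ : ℝ} (hδ : 0 < δ) :
    ∃ W ∈ 𝒲, ∀ f ∈ E, (∀ x ∉ W, f x = 0) → |ψ f| ≤ δ * ‖f‖ := by
  set B : Set ℝ := (fun f => ψ f) '' {f | f ∈ E ∧ ‖f‖ ≤ 1} with hB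
  have hBbdd : BddAbove B := by
    refine ⟨‖ψ‖, ?_⟩
    rintro _ ⟨f, ⟨-, hf⟩, rfl⟩
    calc ψ f ≤ ‖ψ f‖ := le_abs_self _
      _ ≤ ‖ψ‖ * ‖f‖ := ψ.le_opNorm f
      _ ≤ ‖ψ‖ * 1 := by gcongr
      _ = ‖ψ‖ := mul_one _
  have hBne : B.Nonempty := ⟨_, 0, ⟨E.zero_mem, by simp⟩, rfl⟩
  -- `f₀` almost maximizes `ψ` on the unit ball of `E`. Cutting `f₀` off on `W` loses little, and
  -- leaves room to add any `f` in the unit ball supported by `W` without leaving the ball; so `ψ f`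
  -- cannot exceed `δ`.
  obtain ⟨_, ⟨f₀, ⟨hf₀E, hf₀⟩, rfl⟩, hf₀B⟩ :=
    exists_lt_of_lt_csSup hBne (show sSup B - δ / 2 < sSup B by linarith)
  have hψ : 0 < ‖ψ‖ + 1 := by positivity
  obtain ⟨W, hW𝒲, hW⟩ := hsmall f₀ hf₀E (δ / (2 * (‖ψ‖ + 1))) (by positivity)
  have hWc := h𝒲 W hW𝒲
  set g := clopenCut Wᶜ hWc.compl f₀ with hg
  have hgE : g ∈ E := hE _ _ _ hf₀E
  have hψg : sSup B - δ ≤ ψ g := by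
    have h1 : ψ f₀ = ψ (clopenCut W hWc f₀) + ψ g := by
      rw [← map_add, clopenCut_add_clopenCut_compl]
    have h2 : ‖clopenCut W hWc f₀‖ ≤ δ / (2 * (‖ψ‖ + 1)) := by
      refine ZeroAtInftyContinuousMap.norm_le_of_forall_abs_le (by positivity) fun x => ?_
      by_cases h : x ∈ W
      · rw [clopenCut_of_mem hWc _ h]; exact hW x h
      · rw [clopenCut_of_notMem hWc _ h, abs_zero]; positivity
    have h3 : ψ (clopenCut W hWc f₀) ≤ δ / 2 := by
      calc ψ (clopenCut W hWc f₀) ≤ ‖ψ (clopenCut W hWc f₀)‖ := le_abs_self _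
        _ ≤ ‖ψ‖ * ‖clopenCut W hWc f₀‖ := ψ.le_opNorm _
        _ ≤ (‖ψ‖ + 1) * (δ / (2 * (‖ψ‖ + 1))) := by gcongr; linarith
        _ = δ / 2 := by field_simp
    simp only at hf₀B
    linarith
  have key : ∀ f ∈ E, (∀ x ∉ W, f x = 0) → ‖f‖ ≤ 1 → ψ f ≤ δ := by
    intro f hfE hf hf1
    have hmem : ψ (g + f) ∈ B := by
      refine ⟨g + f, ⟨E.add_mem hgE hfE, ?_⟩, rfl⟩
      refine ZeroAtInftyContinuousMap.norm_le_of_forall_abs_le zero_le_one fun x => ?_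
      rw [ZeroAtInftyContinuousMap.add_apply]
      by_cases h : x ∈ W
      · rw [hg, clopenCut_of_notMem _ _ (by simpa using h), zero_add]
        exact (f.abs_apply_le_norm x).trans hf1
      · rw [hg, clopenCut_of_mem _ _ h, hf x h, add_zero]
        exact (f₀.abs_apply_le_norm x).trans hf₀
    have := le_csSup hBbdd hmem
    rw [map_add] at this
    linarith
  refine ⟨W, hW𝒲, fun f hfE hf => ?_⟩
  rcases eq_or_ne f 0 with rfl | hf0
  · simp
  have hn : 0 < ‖f‖ := norm_pos_iff.2 hf0
  have h1 : ∀ c : ℝ, |c| = ‖f‖⁻¹ → c * ψ f ≤ δ := by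
    intro c hc
    have := key (c • f) (E.smul_mem c hfE) (fun x hx => by simp [hf x hx]) (by
      rw [norm_smul, Real.norm_eq_abs, hc, inv_mul_cancel₀ hn.ne'])
    simpa using this
  have h2 := h1 ‖f‖⁻¹ (abs_of_pos (by positivity))
  have h3 := h1 (-‖f‖⁻¹) (by rw [abs_neg]; exact abs_of_pos (by positivity))
  rw [inv_mul_le_iff₀ hn] at h2
  rw [neg_mul, ← mul_neg, inv_mul_le_iff₀ hn] at h3
  rw [mul_comm, abs_le]
  constructor <;> linarith

theorem exists_isClopen_isCompact_superset [LocallyCompactSpace S] [T2Space S]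
    [TotallyDisconnectedSpace S] {K U : Set S} (hK : IsCompact K) (hU : IsOpen U) (hKU : K ⊆ U) :
    ∃ W, IsClopen W ∧ IsCompact W ∧ K ⊆ W ∧ W ⊆ U := by
  have hpt : ∀ x ∈ K, ∃ W, IsClopen W ∧ IsCompact W ∧ x ∈ W ∧ W ⊆ U := by
    intro x hx
    obtain ⟨C, hC, hxC, hCU⟩ := exists_compact_subset hU (hKU hx)
    obtain ⟨W, hW, hxW, hWC⟩ :=
      loc_compact_Haus_tot_disc_of_zero_dim.exists_subset_of_mem_open hxC isOpen_interior
    have hWC' := hWC.trans interior_subset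
    exact ⟨W, hW, hC.of_isClosed_subset hW.isClosed hWC', hxW, hWC'.trans hCU⟩
  choose! W hW hWc hxW hWU using hpt
  obtain ⟨t, htK, ht⟩ := hK.elim_nhds_subcover W fun x hx => (hW x hx).isOpen.mem_nhds (hxW x hx)
  refine ⟨⋃ x ∈ t, W x, t.finite_toSet.isClopen_biUnion fun x hx => hW x (htK x hx),
    t.isCompact_biUnion fun x hx => hWc x (htK x hx), ht, ?_⟩
  exact Set.iUnion₂_subset fun x hx => hWU x (htK x hx)

/-- If the compact subsets of `S` are countable, then bounded functionals on `C₀(S)` are, up to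
arbitrarily small errors, determined by the values at finitely many points. -/
theorem exists_finset_abs_le_of_eqOn_zero [LocallyCompactSpace S] [T2Space S]
    [TotallyDisconnectedSpace S] (hS : ∀ K : Set S, IsCompact K → K.Countable)
    (ψ : C₀(S, ℝ) →L[ℝ] ℝ) {δ : ℝ} (hδ : 0 < δ) :
    ∃ G : Finset S, ∀ f : C₀(S, ℝ), (∀ x ∈ G, f x = 0) → |ψ f| ≤ δ * ‖f‖ := by
  classical
  obtain ⟨W₀', ⟨W₀, hW₀, hW₀c, rfl⟩, hψW₀⟩ := exists_abs_le_of_support_subset ψ ⊤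
    (fun _ _ _ _ => trivial) {W | ∃ V, IsClopen V ∧ IsCompact V ∧ Vᶜ = W}
    (by rintro _ ⟨V, hV, -, rfl⟩; exact hV.compl)
    (fun f _ ε hε => by
      obtain ⟨K, hK, hKf⟩ := f.exists_isCompact_abs_lt hε
      obtain ⟨V, hV, hVc, hKV, -⟩ :=
        exists_isClopen_isCompact_superset hK isOpen_univ (Set.subset_univ K)
      exact ⟨Vᶜ, ⟨V, hV, hVc, rfl⟩, fun x hx => (hKf x fun h => hx (hKV h)).le⟩) (half_pos hδ)
  -- Countability of `W₀` allows positive weights whose finite sums over `W₀` stay below `δ / 2`: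
  -- each point gets its own error budget before the finite subcover is known.
  obtain ⟨η, hη, hηsum⟩ := (hS W₀ hW₀c).exists_pos_forall_sum_le (half_pos hδ)
  have hpt : ∀ s : S, ∃ W, IsClopen W ∧ s ∈ W ∧
      ∀ f : C₀(S, ℝ), f s = 0 → (∀ x ∉ W, f x = 0) → |ψ f| ≤ η s * ‖f‖ := by
    intro s
    obtain ⟨W, ⟨hW, hsW⟩, h⟩ := exists_abs_le_of_support_subset ψ
      (LinearMap.ker (evalFunctional s : C₀(S, ℝ) →ₗ[ℝ] ℝ))
      (fun W hW f hf => clopenCut_apply_eq_zero hW hf) {W | IsClopen W ∧ s ∈ W}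
      (fun W hW => hW.1)
      (fun f hf ε hε => by
        have hO : IsOpen {x | |f x| < ε} :=
          isOpen_lt (map_continuous f).abs continuous_const
        have hs : s ∈ {x | |f x| < ε} := by
          have : f s = 0 := hf
          simpa [this] using hε
        obtain ⟨W, hW, hsW, hWO⟩ :=
          loc_compact_Haus_tot_disc_of_zero_dim.exists_subset_of_mem_open hs hO
        exact ⟨W, ⟨hW, hsW⟩, fun x hx => (hWO hx).le⟩) (hη s)
    exact ⟨W, hW, hsW, fun f hf => h f hf⟩
  choose W hW hsW hψW using hpt
  obtain ⟨t, htW₀, ht⟩ := hW₀c.elim_nhds_subcover W fun x _ => (hW x).isOpen.mem_nhds (hsW x)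
  -- The sets `W s` may overlap, so they are peeled off one at a time: the part of `f` on `W a`
  -- costs `η a * ‖f‖`, and the rest is supported by the remaining sets.
  have hsum : ∀ u : Finset S, ∀ f : C₀(S, ℝ), (∀ x ∈ u, f x = 0) →
      (∀ x, (∀ s ∈ u, x ∉ W s) → f x = 0) → |ψ f| ≤ (∑ s ∈ u, η s) * ‖f‖ := by
    intro u
    induction u using Finset.induction_on with
    | empty =>
      intro f _ hf
      have : f = 0 := by ext x; exact hf x (by simp)
      simp [this]
    | insert a u ha ih =>
      intro f hfu hf
      have h1 := hψW a (clopenCut (W a) (hW a) f)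
        (clopenCut_apply_eq_zero _ (hfu a (Finset.mem_insert_self a u)))
        (fun x hx => clopenCut_of_notMem _ _ hx)
      have h2 := ih (clopenCut (W a)ᶜ (hW a).compl f)
        (fun x hx => clopenCut_apply_eq_zero _ (hfu x (Finset.mem_insert_of_mem hx)))
        (fun x hx => by
          by_cases hxa : x ∈ W a
          · exact clopenCut_of_notMem _ _ (by simpa using hxa)
          · refine clopenCut_apply_eq_zero _ (hf x fun s hs => ?_)
            rcases Finset.mem_insert.1 hs with rfl | hs
            · exact hxa
            · exact hx s hs)
      rw [← clopenCut_add_clopenCut_compl (hW a) f, map_add,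
        clopenCut_add_clopenCut_compl, Finset.sum_insert ha, add_mul]
      refine (abs_add_le _ _).trans (add_le_add (h1.trans ?_) (h2.trans ?_))
      · exact mul_le_mul_of_nonneg_left (norm_clopenCut_le _ f) (hη a).le
      · exact mul_le_mul_of_nonneg_left (norm_clopenCut_le _ f)
          (Finset.sum_nonneg fun s _ => (hη s).le)
  refine ⟨t, fun f hf => ?_⟩
  have h1 := hsum t (clopenCut W₀ hW₀ f) (fun x hx => clopenCut_apply_eq_zero _ (hf x hx))
    (fun x hx => clopenCut_of_notMem _ _ fun h => by
      obtain ⟨s, hs, hxs⟩ := Set.mem_iUnion₂.1 (ht h)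
      exact hx s hs hxs)
  have h2 := hψW₀ (clopenCut W₀ᶜ hW₀.compl f) trivial fun x hx => clopenCut_of_notMem _ _ hx
  have h3 := hηsum t htW₀
  have hsplit : ψ f = ψ (clopenCut W₀ hW₀ f) + ψ (clopenCut W₀ᶜ hW₀.compl f) := by
    rw [← map_add, clopenCut_add_clopenCut_compl]
  rw [hsplit]
  calc |ψ (clopenCut W₀ hW₀ f) + ψ (clopenCut W₀ᶜ hW₀.compl f)|
      ≤ |ψ (clopenCut W₀ hW₀ f)| + |ψ (clopenCut W₀ᶜ hW₀.compl f)| := abs_add_le _ _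
    _ ≤ δ / 2 * ‖f‖ + δ / 2 * ‖f‖ := by
        refine add_le_add (h1.trans ?_) (h2.trans ?_)
        · exact mul_le_mul h3 (norm_clopenCut_le _ f) (norm_nonneg _) (half_pos hδ).le
        · exact mul_le_mul_of_nonneg_left (norm_clopenCut_le _ f) (half_pos hδ).le
    _ = δ * ‖f‖ := by ring

end FunctionsVanishingAtInfinity

/-! ### Finite-to-one maps onto `ω₁`: countability, roots and collapsing -/

section FiniteToOne

open Filter Topology

variable {L : Type*} [TopologicalSpace L] {φ : L → Ordinal.{0}}

theorem exists_lt_omega_one_forall_le {ι : Type*} [Countable ι] (f : ι → Ordinal.{0})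
    (hf : ∀ i, f i < ω_ 1) : ∃ β < ω_ 1, ∀ i, f i ≤ β :=
  ⟨⨆ i, f i, Ordinal.iSup_lt_omega_one hf, fun i => Ordinal.le_iSup f i⟩

theorem countable_Iio_of_lt_omega_one {β : Ordinal.{0}} (hβ : β < ω_ 1) :
    (Set.Iio β).Countable := by
  rw [← Cardinal.le_aleph0_iff_set_countable, Cardinal.mk_Iio_ordinal, ← Cardinal.lift_aleph0.{1, 0},
    Cardinal.lift_le]
  have h := Cardinal.lt_omega_iff_card_lt.1 hβ
  rwa [← Cardinal.succ_aleph0, Order.lt_succ_iff] at h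

theorem omega_one_succ_lt {β : Ordinal.{0}} (hβ : β < ω_ 1) : Order.succ β < ω_ 1 :=
  (Cardinal.isSuccLimit_omega 1).succ_lt hβ

/-- If tuples of a family which decreases with `β` exist for all countable `β`, then, for a suitable
set `R` of indices, they may be chosen so that the coordinates in `R` are uniformly bounded whereas
the remaining ones are arbitrarily large. -/
theorem exists_root {L : Type*} (φ : L → Ordinal.{0}) {ι : Type*} [Finite ι]
    (P : Ordinal.{0} → (ι → L) → Prop) (hP : ∀ β γ x, β ≤ γ → P γ x → P β x)
    (hex : ∀ β < ω_ 1, ∃ x, P β x) :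
    ∃ (R : Set ι) (ζ : Ordinal.{0}), ζ < ω_ 1 ∧
      ∀ β < ω_ 1, ∃ x, P β x ∧ (∀ i ∈ R, φ (x i) ≤ ζ) ∧ ∀ i ∉ R, β < φ (x i) := by
  obtain ⟨R, ⟨ζ, hζ, hR⟩, hmax⟩ := (Set.toFinite {R : Set ι | ∃ ζ < ω_ 1, ∀ β < ω_ 1, ∃ x, P β x ∧
    ∀ i ∈ R, φ (x i) ≤ ζ}).exists_maximal ⟨∅, 0, Ordinal.omega_pos 1, fun β hβ => by
      simpa using hex β hβ⟩
  refine ⟨R, ζ, hζ, fun β hβ => ?_⟩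
  have hstep : ∀ i, ∃ γ < ω_ 1, i ∉ R → ∀ x, P γ x → (∀ j ∈ R, φ (x j) ≤ ζ) → β < φ (x i) := by
    intro i
    by_contra! hcon
    refine (hcon 0 (Ordinal.omega_pos 1)).1 (hmax ⟨max ζ β, max_lt hζ hβ, fun γ hγ => ?_⟩
      (Set.subset_insert i R) (Set.mem_insert i R))
    obtain ⟨-, x, hx, hxR, hxi⟩ := hcon γ hγ
    refine ⟨x, hx, fun j hj => ?_⟩
    rcases hj with rfl | hj
    · exact le_max_of_le_right hxi
    · exact le_max_of_le_left (hxR j hj)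
  choose γ hγ hγi using hstep
  obtain ⟨δ, hδ, hγδ⟩ := exists_lt_omega_one_forall_le γ hγ
  obtain ⟨x, hx, hxR⟩ := hR (max δ β) (max_lt hδ hβ)
  exact ⟨x, hP _ _ _ (le_max_right _ _) hx, hxR, fun i hi =>
    hγi i hi x (hP _ _ _ ((hγδ i).trans (le_max_left _ _)) hx) hxR⟩

namespace IsFiniteToOneOntoOmegaOne

theorem lt_omega_one (hφ : IsFiniteToOneOntoOmegaOne φ) (x : L) : φ x < ω_ 1 := by
  have : φ x ∈ Set.range φ := ⟨x, rfl⟩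
  rwa [hφ.range_eq] at this

theorem countable_initialPart (hφ : IsFiniteToOneOntoOmegaOne φ) {α : Ordinal.{0}}
    (hα : α < ω_ 1) : (initialPart φ α).Countable := by
  have : initialPart φ α = ⋃ γ ∈ Set.Iio α, φ ⁻¹' {γ} := by
    ext x; simp [initialPart]
  rw [this]
  exact (countable_Iio_of_lt_omega_one hα).biUnion fun γ hγ =>
    (hφ.finite_fiber γ (lt_trans hγ hα)).countable

theorem countable_of_isCompact (hφ : IsFiniteToOneOntoOmegaOne φ) {K : Set L}
    (hK : IsCompact K) : K.Countable := by
  rcases K.eq_empty_or_nonempty with rfl | hne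
  · exact Set.countable_empty
  obtain ⟨x, -, hx⟩ := hK.exists_isMaxOn hne hφ.continuous.continuousOn
  refine (hφ.countable_initialPart (omega_one_succ_lt (hφ.lt_omega_one x))).mono fun y hy => ?_
  have hyx : φ y ≤ φ x := hx hy
  exact Order.lt_succ_of_le hyx

theorem countable_of_isCompact_prod (hφ : IsFiniteToOneOntoOmegaOne φ) {K : Set (L × L)}
    (hK : IsCompact K) : K.Countable :=
  ((hφ.countable_of_isCompact (hK.image continuous_fst)).prod
    (hφ.countable_of_isCompact (hK.image continuous_snd))).mono Set.subset_fst_image_prod_snd_image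

theorem isOpen_setOf_le (hφ : IsFiniteToOneOntoOmegaOne φ) (β : Ordinal.{0}) :
    IsOpen {x | φ x ≤ β} := by
  have : {x | φ x ≤ β} = φ ⁻¹' Set.Iio (Order.succ β) := by
    ext x; simp
  rw [this]
  exact isOpen_Iio.preimage hφ.continuous

theorem isOpen_setOf_lt (hφ : IsFiniteToOneOntoOmegaOne φ) (β : Ordinal.{0}) :
    IsOpen {x | β < φ x} := isOpen_Ioi.preimage hφ.continuous

/-- The sets `{φ ≤ β}` are clopen, so a preconnected set lies in one fibre. Fibres are finite,
whereas a nontrivial preconnected set in a Hausdorff space is infinite. -/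
theorem totallyDisconnectedSpace [T2Space L] (hφ : IsFiniteToOneOntoOmegaOne φ) :
    TotallyDisconnectedSpace L := by
  refine ⟨fun s _ hs => ?_⟩
  by_contra hns
  have hle : ∀ x ∈ s, ∀ y ∈ s, φ y ≤ φ x := by
    intro x hx y hy
    have hclopen : IsClopen {z | φ z ≤ φ x} :=
      ⟨isClosed_Iic.preimage hφ.continuous, hφ.isOpen_setOf_le _⟩
    exact hs.subset_isClopen hclopen ⟨x, hx, le_refl (φ x)⟩ hy
  have hs' : s.Nontrivial := Set.not_subsingleton_iff.1 hns
  obtain ⟨x, hx⟩ := hs'.nonempty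
  refine hs.infinite_of_nontrivial hs' ((hφ.finite_fiber _ (hφ.lt_omega_one x)).subset ?_)
  exact fun y hy => le_antisymm (hle x hx y hy) (hle y hy x hx)

/-- A family of finite tuples with arbitrarily large coordinates has an uncountable subfamily of
tuples with pairwise disjoint ranges. -/
theorem exists_uncountable_pairwiseDisjoint_range (hφ : IsFiniteToOneOntoOmegaOne φ)
    {ι : Type*} [Finite ι] [Nonempty ι] (D : Set (ι → L))
    (hD : ∀ β < ω_ 1, ∃ w ∈ D, ∀ i, β < φ (w i)) :
    ∃ C ⊆ D, ¬ C.Countable ∧ C.PairwiseDisjoint Set.range := by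
  obtain ⟨C, ⟨hCD, hC⟩, hmax⟩ := zorn_subset {C : Set (ι → L) | C ⊆ D ∧ C.PairwiseDisjoint Set.range}
    fun c hc hchain => ⟨⋃₀ c, ⟨Set.sUnion_subset fun C hC => (hc hC).1,
      (Set.pairwiseDisjoint_sUnion hchain.directedOn).2 fun C hC => (hc hC).2⟩,
      fun C hC => Set.subset_sUnion_of_mem hC⟩
  refine ⟨C, hCD, fun hcount => ?_, hC⟩
  have := hcount.to_subtype
  obtain ⟨β, hβ, hCβ⟩ := exists_lt_omega_one_forall_le (fun z : C × ι => φ (z.1.1 z.2))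
    fun z => hφ.lt_omega_one _
  obtain ⟨w, hwD, hw⟩ := hD β hβ
  have hdisj : ∀ v ∈ C, Disjoint (Set.range w) (Set.range v) := by
    intro v hv
    rw [Set.disjoint_left]
    rintro _ ⟨i, rfl⟩ ⟨j, hj⟩
    have := hCβ (⟨v, hv⟩, j)
    simp only [hj] at this
    exact (hw i).not_ge this
  -- Maximality puts `w` into `C`, so its nonempty range would be disjoint from itself.
  have hwC : w ∈ C := by
    refine hmax ⟨Set.insert_subset hwD hCD, hC.insert fun v hv _ => hdisj v hv⟩
      (Set.subset_insert w C) (Set.mem_insert w C)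
  obtain ⟨i⟩ := ‹Nonempty ι›
  exact Set.disjoint_left.1 (hdisj w hwC) ⟨i, rfl⟩ ⟨i, rfl⟩

/-- The collapsing property for three blocks and an arbitrary finite index set. -/
theorem exists_limits_of_collapsingProperty [T2Space L] (hφ : IsFiniteToOneOntoOmegaOne φ)
    (hL : CollapsingProperty L) {ι : Type*} [Fintype ι] (p : ι → Fin 3)
    (hp : Function.Surjective p) (D : Set (ι → L)) (hinj : ∀ w ∈ D, Function.Injective w)
    (hD : ∀ β < ω_ 1, ∃ w ∈ D, ∀ i, β < φ (w i)) :
    ∃ a b : L, a ≠ b ∧ ∀ U ∈ 𝓝 a, ∀ V ∈ 𝓝 b, ∀ K : Set L, IsCompact K →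
      ∃ w ∈ D, ∀ i, (p i = 0 → w i ∈ U) ∧ (p i = 1 → w i ∈ V) ∧ (p i = 2 → w i ∉ K) := by
  have hne : Nonempty ι := ⟨(hp 0).choose⟩
  obtain ⟨C, hCD, hCunc, hC⟩ := hφ.exists_uncountable_pairwiseDisjoint_range D hD
  let e := Fintype.equivFin ι
  let C' : Set (Fin (Fintype.card ι) → L) := (fun w => w ∘ e.symm) '' C
  have hC'inj : ∀ v ∈ C', Function.Injective v := by
    rintro _ ⟨w, hw, rfl⟩
    exact (hinj w (hCD hw)).comp e.symm.injective
  have hsep : IsSeparated (p ∘ e.symm) C' := by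
    -- By injectivity of the tuples, each block has as many points as its label has indices.
    refine ⟨⟨fun j => ((p ∘ e.symm) ⁻¹' {j}).ncard, fun j => ⟨?_, fun v hv => ?_⟩⟩, ?_⟩
    · obtain ⟨i, hi⟩ := (hp.comp e.symm.surjective) j
      exact (Set.ncard_pos (Set.toFinite _)).2 ⟨i, hi⟩ |>.ne'
    · exact Set.ncard_image_of_injective _ (hC'inj v hv)
    · intro v hv v' hv' i j hij
      by_cases hvv : v = v'
      · subst hvv
        have hij' : i ≠ j := hij.resolve_right fun h => h rfl
        refine (Set.disjoint_image_iff (hC'inj v hv)).2 ?_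
        exact (Set.disjoint_singleton.2 hij').preimage _
      · obtain ⟨w, hw, rfl⟩ := hv
        obtain ⟨w', hw', rfl⟩ := hv'
        have hww : w ≠ w' := fun h => hvv (by rw [h])
        refine (hC hw hw' hww).mono ?_ ?_ <;>
        · rintro _ ⟨l, -, rfl⟩
          exact ⟨_, rfl⟩
  have hC'unc : ¬ C'.Countable := fun h =>
    hCunc (Set.countable_of_injective_of_countable_image
      (e.symm.surjective.injective_comp_right.injOn) h)
  obtain ⟨q, hq, a, hainj, halast, hqa⟩ := hL _ 2 Fintype.card_pos (p ∘ e.symm)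
    (hp.comp e.symm.surjective) C' hC'unc hsep
  have h2 : a 2 = OnePoint.infty := halast
  have hreal : ∀ l : Fin 3, l ≠ 2 → ∃ b : L, (b : OnePoint L) = a l := by
    intro l hl
    refine OnePoint.ne_infty_iff_exists.1 fun h => hl (hainj (h.trans h2.symm))
  obtain ⟨a₀, ha₀⟩ := hreal 0 (by decide)
  obtain ⟨a₁, ha₁⟩ := hreal 1 (by decide)
  refine ⟨a₀, a₁, ?_, fun U hU V hV K hK => ?_⟩
  · rintro rfl
    exact absurd (hainj (ha₀.symm.trans ha₁)) (by decide)
  let N : Fin 3 → Set (OnePoint L) := ![(↑) '' U, (↑) '' V, ((↑) '' K)ᶜ]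
  have hN : ∀ l, N l ∈ 𝓝 (a l) := by
    intro l
    fin_cases l
    · change ((↑) '' U : Set (OnePoint L)) ∈ 𝓝 (a 0)
      rw [← ha₀]
      exact OnePoint.isOpenEmbedding_coe.image_mem_nhds.2 hU
    · change ((↑) '' V : Set (OnePoint L)) ∈ 𝓝 (a 1)
      rw [← ha₁]
      exact OnePoint.isOpenEmbedding_coe.image_mem_nhds.2 hV
    · change ((↑) '' K : Set (OnePoint L))ᶜ ∈ 𝓝 (a 2)
      rw [h2]
      exact (OnePoint.isOpen_compl_image_coe.2 ⟨hK.isClosed, hK⟩).mem_nhds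
        OnePoint.infty_notMem_image_coe
  have hnhds : Set.univ.pi (fun i => N ((p ∘ e.symm) i)) ∈ 𝓝 q :=
    set_pi_mem_nhds Set.finite_univ fun i _ => by rw [hqa i]; exact hN _
  obtain ⟨_, ⟨hmem, ⟨_, ⟨w, hw, rfl⟩, rfl⟩⟩, -⟩ := accPt_iff_nhds.1 hq _ hnhds
  refine ⟨w, hCD hw, fun i => ?_⟩
  have hi : (w i : OnePoint L) ∈ N (p i) := by
    simpa using hmem (e i) trivial
  refine ⟨fun h => ?_, fun h => ?_, fun h => ?_⟩ <;> rw [h] at hi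
  · obtain ⟨z, hz, hzw⟩ := hi
    rwa [← OnePoint.coe_injective hzw]
  · obtain ⟨z, hz, hzw⟩ := hi
    rwa [← OnePoint.coe_injective hzw]
  · exact fun hwK => hi ⟨_, hwK, rfl⟩

end IsFiniteToOneOntoOmegaOne

end FiniteToOne

/-! ### Operators from `C₀(L × L)` into `C₀(L)` -/

section Operators

open Filter Topology

variable {L : Type*} [TopologicalSpace L] {φ : L → Ordinal.{0}}

/-- The indicator function of the product of two compact clopen sets. -/
noncomputable def rectangleIndicator (U V : Set L) (hU : IsClopen U) (hUc : IsCompact U)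
    (hV : IsClopen V) (hVc : IsCompact V) : C₀(L × L, ℝ) :=
  compactIndicator (U ×ˢ V) (hU.prod hV) (hUc.prod hVc)

/-- The tuple `x` witnesses that `T` does not vanish at the indicator of a rectangle `U × V` with
disjoint sides beyond `β`: this is seen at the point `x i₀`, where `T` depends, up to a small error,
only on the values at the points `(x i, x j)`. The labels `0` and `1` of `p` mark the coordinates
in `U` and in `V`. -/
structure IsRectangleWitness (φ : L → Ordinal.{0}) (T : C₀(L × L, ℝ) →L[ℝ] C₀(L, ℝ)) (ε : ℝ)
    {ι : Type*} (p : ι → Fin 3) (i₀ : ι) (β : Ordinal.{0}) (x : ι → L) : Prop where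
  injective : Function.Injective x
  exists_rectangle : ∃ (U V : Set L) (hU : IsClopen U) (hUc : IsCompact U) (hV : IsClopen V)
    (hVc : IsCompact V), Disjoint U V ∧ (∀ z ∈ U, β < φ z) ∧ (∀ z ∈ V, β < φ z) ∧
      (∀ i, x i ∈ U ↔ p i = 0) ∧ (∀ i, x i ∈ V ↔ p i = 1) ∧
      ε < |T (rectangleIndicator U V hU hUc hV hVc) (x i₀)|
  abs_apply_le : ∀ h : C₀(L × L, ℝ), (∀ i j, h (x i, x j) = 0) → |T h (x i₀)| ≤ ε / 4 * ‖h‖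

theorem IsRectangleWitness.mono {T : C₀(L × L, ℝ) →L[ℝ] C₀(L, ℝ)} {ε : ℝ} {ι : Type*}
    {p : ι → Fin 3} {i₀ : ι} {β γ : Ordinal.{0}} {x : ι → L} (hβγ : β ≤ γ)
    (h : IsRectangleWitness φ T ε p i₀ γ x) : IsRectangleWitness φ T ε p i₀ β x := by
  obtain ⟨hinj, ⟨U, V, hU, hUc, hV, hVc, hUV, hφU, hφV, hrest⟩, hle⟩ := h
  exact ⟨hinj, ⟨U, V, hU, hUc, hV, hVc, hUV, fun z hz => hβγ.trans_lt (hφU z hz),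
    fun z hz => hβγ.trans_lt (hφV z hz), hrest⟩, hle⟩

/-- If a label were missing, the indicator would vanish at all pairs `(x i, x j)`, forcing its image
at `x i₀` to be at most `ε / 4`. -/
theorem IsRectangleWitness.exists_label_eq {T : C₀(L × L, ℝ) →L[ℝ] C₀(L, ℝ)} {ε : ℝ}
    (hε : 0 < ε) {ι : Type*} {p : ι → Fin 3} {i₀ : ι} {β : Ordinal.{0}} {x : ι → L}
    (h : IsRectangleWitness φ T ε p i₀ β x) : (∃ i, p i = 0) ∧ ∃ i, p i = 1 := by
  obtain ⟨U, V, hU, hUc, hV, hVc, -, -, -, hxU, hxV, hlt⟩ := h.exists_rectangle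
  have key : ∃ i j, p i = 0 ∧ p j = 1 := by
    by_contra! hcon
    have h1 := h.abs_apply_le (rectangleIndicator U V hU hUc hV hVc) fun i j =>
      compactIndicator_of_notMem _ _ fun hm => hcon i j ((hxU i).1 hm.1) ((hxV j).1 hm.2)
    have h2 : ‖rectangleIndicator U V hU hUc hV hVc‖ ≤ 1 := norm_compactIndicator_le _ _
    nlinarith
  obtain ⟨i, j, hi, hj⟩ := key
  exact ⟨⟨i, hi⟩, ⟨j, hj⟩⟩

namespace IsFiniteToOneOntoOmegaOne

variable [T2Space L] [LocallyCompactSpace L]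

/-- A bounded functional on `C₀(L × L)` annihilates the functions supported beyond some countable
ordinal. -/
theorem exists_forall_apply_eq_zero (hφ : IsFiniteToOneOntoOmegaOne φ)
    (ψ : C₀(L × L, ℝ) →L[ℝ] ℝ) : ∃ β < ω_ 1, ∀ f : C₀(L × L, ℝ),
      (∀ x y, φ x ≤ β → f (x, y) = 0) → ψ f = 0 := by
  have := hφ.totallyDisconnectedSpace
  have hG := fun n : ℕ => exists_finset_abs_le_of_eqOn_zero
    (fun K hK => hφ.countable_of_isCompact_prod hK) ψ (Nat.one_div_pos_of_nat (α := ℝ) (n := n))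
  choose G hG using hG
  obtain ⟨β, hβ, hGβ⟩ := exists_lt_omega_one_forall_le
    (fun z : Σ n, G n => φ (z.2 : L × L).1) fun z => hφ.lt_omega_one _
  refine ⟨β, hβ, fun f hf => abs_eq_zero.1 (le_antisymm ?_ (abs_nonneg _))⟩
  have hle : ∀ n : ℕ, |ψ f| ≤ 1 / ((n : ℝ) + 1) * ‖f‖ := fun n =>
    hG n f fun x hx => hf x.1 x.2 (hGβ ⟨n, x, hx⟩)
  have ht : Tendsto (fun n : ℕ => 1 / ((n : ℝ) + 1) * ‖f‖) atTop (𝓝 (0 * ‖f‖)) :=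
    tendsto_one_div_add_atTop_nhds_zero_nat.mul_const _
  rw [zero_mul] at ht
  exact ge_of_tendsto' ht hle

/-- If `T` does not vanish at the rectangles with disjoint sides beyond every countable ordinal,
then witnesses of a fixed kind exist beyond every countable ordinal. -/
theorem exists_isRectangleWitness (hφ : IsFiniteToOneOntoOmegaOne φ)
    (T : C₀(L × L, ℝ) →L[ℝ] C₀(L, ℝ))
    (hT : ∀ β < ω_ 1, ∃ (U V : Set L) (hU : IsClopen U) (hUc : IsCompact U) (hV : IsClopen V)
      (hVc : IsCompact V), Disjoint U V ∧ (∀ z ∈ U, β < φ z) ∧ (∀ z ∈ V, β < φ z) ∧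
        T (rectangleIndicator U V hU hUc hV hVc) ≠ 0) :
    ∃ ε > 0, ∃ (n : ℕ) (p : Fin n → Fin 3) (i₀ : Fin n), ∀ β < ω_ 1, ∃ x,
      IsRectangleWitness φ T ε p i₀ β x := by
  classical
  have := hφ.totallyDisconnectedSpace
  -- A kind `d` records the length, the labelling, the index `i₀` and the `m` with `ε = 1 / (m +
  -- 1)`. There are only countably many kinds, so one of them occurs beyond every countable ordinal.
  have hex : ∀ β < ω_ 1, ∃ (d : Σ n : ℕ, (Fin n → Fin 3) × Fin n × ℕ), ∃ x,
      IsRectangleWitness φ T (1 / ((d.2.2.2 : ℝ) + 1)) d.2.1 d.2.2.1 β x := by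
    intro β hβ
    obtain ⟨U, V, hU, hUc, hV, hVc, hUV, hφU, hφV, hne⟩ := hT β hβ
    obtain ⟨y, hy⟩ : ∃ y, T (rectangleIndicator U V hU hUc hV hVc) y ≠ 0 := by
      by_contra! hcon
      exact hne (ZeroAtInftyContinuousMap.ext hcon)
    obtain ⟨m, hm⟩ := exists_nat_one_div_lt (abs_pos.2 hy)
    obtain ⟨G, hG⟩ := exists_finset_abs_le_of_eqOn_zero
      (fun K hK => hφ.countable_of_isCompact_prod hK) ((evalFunctional y).comp T)
      (show (0 : ℝ) < 1 / ((m : ℝ) + 1) / 4 by positivity)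
    let A : Finset L := insert y (G.image Prod.fst ∪ G.image Prod.snd)
    let e := A.equivFin
    let x : Fin A.card → L := fun i => e.symm i
    have hx : ∀ z ∈ A, ∃ i, x i = z := fun z hz => ⟨e ⟨z, hz⟩, by simp [x]⟩
    obtain ⟨i₀, hi₀⟩ := hx y (Finset.mem_insert_self _ _)
    let p : Fin A.card → Fin 3 := fun i => if x i ∈ U then 0 else if x i ∈ V then 1 else 2
    refine ⟨⟨A.card, p, i₀, m⟩, x, ?_, ⟨U, V, hU, hUc, hV, hVc, hUV, hφU, hφV, ?_, ?_, ?_⟩, ?_⟩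
    · exact Subtype.val_injective.comp e.symm.injective
    · intro i
      by_cases h : x i ∈ U <;> by_cases h' : x i ∈ V <;> simp [p, h, h']
    · intro i
      by_cases h : x i ∈ U
      · have h' := Set.disjoint_left.1 hUV h
        simp [p, h, h']
      · by_cases h' : x i ∈ V <;> simp [p, h, h']
    · rwa [hi₀]
    · intro h hh
      rw [hi₀]
      refine hG h fun z hz => ?_
      obtain ⟨i, hi⟩ := hx z.1 (Finset.mem_insert_of_mem (Finset.mem_union_left _
        (Finset.mem_image_of_mem _ hz)))
      obtain ⟨j, hj⟩ := hx z.2 (Finset.mem_insert_of_mem (Finset.mem_union_right _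
        (Finset.mem_image_of_mem _ hz)))
      have := hh i j
      rwa [hi, hj] at this
  by_contra! hcon
  have hcon' : ∀ d : Σ n : ℕ, (Fin n → Fin 3) × Fin n × ℕ, ∃ β < ω_ 1, ∀ x,
      ¬ IsRectangleWitness φ T (1 / ((d.2.2.2 : ℝ) + 1)) d.2.1 d.2.2.1 β x := fun d =>
    hcon _ (by positivity) d.1 d.2.1 d.2.2.1
  choose β hβ hβd using hcon'
  obtain ⟨γ, hγ, hβγ⟩ := exists_lt_omega_one_forall_le β hβ
  obtain ⟨d, x, hx⟩ := hex γ hγ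
  exact hβd d x (hx.mono (hβγ d))

/-- Witnesses of a fixed kind cannot exist beyond every countable ordinal: pairs `(x, y)` of them can
be made to collapse so that `x i₀` and `y i₀` have the same limit, whereas the values at `x i₀` and
`y i₀` of the image of the indicator of a suitable rectangle remain apart. -/
theorem not_forall_exists_isRectangleWitness (hφ : IsFiniteToOneOntoOmegaOne φ)
    (hL : CollapsingProperty L) (T : C₀(L × L, ℝ) →L[ℝ] C₀(L, ℝ)) {ε : ℝ} (hε : 0 < ε)
    {ι : Type*} [Finite ι] (p : ι → Fin 3) (i₀ : ι) :
    ¬ ∀ β < ω_ 1, ∃ x, IsRectangleWitness φ T ε p i₀ β x := by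
  classical
  intro hex
  have := hφ.totallyDisconnectedSpace
  obtain ⟨R, ζ, hζ, hR⟩ := exists_root φ (IsRectangleWitness φ T ε p i₀)
    (fun β γ x hβγ h => h.mono hβγ) hex
  have hpR : ∀ i, p i = 0 ∨ p i = 1 → i ∉ R := by
    intro i hi hiR
    obtain ⟨x, hx, hxR, -⟩ := hR ζ hζ
    obtain ⟨U, V, -, -, -, -, -, hφU, hφV, hxU, hxV, -⟩ := hx.exists_rectangle
    rcases hi with hi | hi
    · exact (hφU _ ((hxU i).2 hi)).not_ge (hxR i hiR)
    · exact (hφV _ ((hxV i).2 hi)).not_ge (hxR i hiR)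
  -- Only countably many points lie at or below level `ζ`, and evaluating `T` at each of them kills
  -- everything supported far enough out.
  have hi₀R : i₀ ∉ R := by
    intro hi₀
    have hcount : Countable (initialPart φ (Order.succ ζ)) :=
      (hφ.countable_initialPart (omega_one_succ_lt hζ)).to_subtype
    choose β hβ hβy using fun y : initialPart φ (Order.succ ζ) =>
      hφ.exists_forall_apply_eq_zero ((evalFunctional (y : L)).comp T)
    obtain ⟨γ, hγ, hβγ⟩ := exists_lt_omega_one_forall_le β hβ
    obtain ⟨x, hx, hxR, -⟩ := hR γ hγ
    obtain ⟨U, V, hU, hUc, hV, hVc, -, hφU, -, -, -, hlt⟩ := hx.exists_rectangle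
    have h0 := hβy ⟨x i₀, Order.lt_succ_of_le (hxR i₀ hi₀)⟩ (rectangleIndicator U V hU hUc hV hVc)
      fun z w hz => compactIndicator_of_notMem _ _ fun hm =>
        (hφU z hm.1).not_ge (hz.trans (hβγ _))
    have h0' : T (rectangleIndicator U V hU hUc hV hVc) (x i₀) = 0 := h0
    rw [h0', abs_zero] at hlt
    exact lt_asymm hε hlt
  obtain ⟨⟨j₀, hj₀⟩, ⟨j₁, hj₁⟩⟩ : (∃ i, p i = 0) ∧ ∃ i, p i = 1 := by
    obtain ⟨x, hx⟩ := hex 0 (Ordinal.omega_pos 1)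
    exact hx.exists_label_eq hε
  let κ := {i // i ∉ R}
  have : Fintype κ := Fintype.ofFinite κ
  -- The copy of `x` keeps its labels. In the copy of `y` only `i₀` does; everything else is sent to
  -- `∞`.
  let q : κ ⊕ κ → Fin 3 := Sum.elim (fun i => p i) fun i => if i.1 = i₀ then p i₀ else 2
  have hq : Function.Surjective q := by
    intro l
    fin_cases l
    · exact ⟨Sum.inl ⟨j₀, hpR j₀ (Or.inl hj₀)⟩, hj₀⟩
    · exact ⟨Sum.inl ⟨j₁, hpR j₁ (Or.inr hj₁)⟩, hj₁⟩
    -- Label `2` must occur: at most one of the distinct indices `j₀`, `j₁` is `i₀`.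
    · by_cases h : j₀ = i₀
      · refine ⟨Sum.inr ⟨j₁, hpR j₁ (Or.inr hj₁)⟩, if_neg ?_⟩
        rintro rfl
        rw [h, hj₁] at hj₀
        exact absurd hj₀ (by decide)
      · exact ⟨Sum.inr ⟨j₀, hpR j₀ (Or.inl hj₀)⟩, if_neg h⟩
  let D : Set (κ ⊕ κ → L) := {w | Function.Injective w ∧ (∀ i, ζ < φ (w i)) ∧ ∃ x y,
    IsRectangleWitness φ T ε p i₀ ζ x ∧ IsRectangleWitness φ T ε p i₀ ζ y ∧
    (∀ i ∈ R, φ (x i) ≤ ζ) ∧ (∀ i ∈ R, φ (y i) ≤ ζ) ∧ (∀ i : κ, w (Sum.inl i) = x i) ∧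
    ∀ i : κ, w (Sum.inr i) = y i}
  have hD : ∀ β < ω_ 1, ∃ w ∈ D, ∀ i, β < φ (w i) := by
    intro β hβ
    obtain ⟨x, hx, hxR, hxβ⟩ := hR (max ζ β) (max_lt hζ hβ)
    obtain ⟨γ, hγ, hxγ⟩ := exists_lt_omega_one_forall_le (fun i => φ (x i))
      fun i => hφ.lt_omega_one _
    -- Taking `y` beyond all coordinates of `x` makes the combined tuple injective.
    obtain ⟨y, hy, hyR, hyβ⟩ := hR (max γ (max ζ β)) (max_lt hγ (max_lt hζ hβ))
    have hbig : ∀ i : κ ⊕ κ, max ζ β < φ (Sum.elim (fun i : κ => x i) (fun i : κ => y i) i) := by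
      rintro (i | i)
      · exact hxβ i i.2
      · exact (le_max_right _ _).trans_lt (hyβ i i.2)
    refine ⟨Sum.elim (fun i => x i) (fun i => y i), ⟨?_, fun i => (le_max_left _ _).trans_lt (hbig i),
      x, y, hx.mono (le_max_left _ _), hy.mono ((le_max_left _ _).trans (le_max_right _ _)), hxR, hyR,
      fun _ => rfl, fun _ => rfl⟩, fun i => (le_max_right _ _).trans_lt (hbig i)⟩
    refine (hx.injective.comp Subtype.val_injective).sumElim
      (hy.injective.comp Subtype.val_injective) fun i j hij => ?_
    have h1 := hyβ j j.2
    have h2 : x i = y j := hij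
    rw [← h2] at h1
    exact (lt_of_le_of_lt (le_max_left _ _) h1).not_ge (hxγ i)
  obtain ⟨a, b, hab, hlim⟩ :=
    hφ.exists_limits_of_collapsingProperty hL q hq D (fun w hw => hw.1) hD
  have ha : ζ < φ a := by
    by_contra! h
    obtain ⟨w, hw, hwi⟩ := hlim _ ((hφ.isOpen_setOf_le ζ).mem_nhds h) _ univ_mem ∅ isCompact_empty
    obtain ⟨i, hi⟩ := hq 0
    exact (hw.2.1 i).not_ge ((hwi i).1 hi)
  have hb : ζ < φ b := by
    by_contra! h
    obtain ⟨w, hw, hwi⟩ := hlim _ univ_mem _ ((hφ.isOpen_setOf_le ζ).mem_nhds h) ∅ isCompact_empty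
    obtain ⟨i, hi⟩ := hq 1
    exact (hw.2.1 i).not_ge ((hwi i).2.1 hi)
  obtain ⟨O₁, O₂, hO₁, hO₂, haO, hbO, hO⟩ := t2_separation hab
  obtain ⟨U', hU', hU'c, haU', hU'O⟩ := exists_isClopen_isCompact_superset
    (isCompact_singleton (x := a)) (hO₁.inter (hφ.isOpen_setOf_lt ζ))
    (Set.singleton_subset_iff.2 ⟨haO, ha⟩)
  obtain ⟨V', hV', hV'c, hbV', hV'O⟩ := exists_isClopen_isCompact_superset
    (isCompact_singleton (x := b)) (hO₂.inter (hφ.isOpen_setOf_lt ζ))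
    (Set.singleton_subset_iff.2 ⟨hbO, hb⟩)
  have hUV' : ∀ z ∈ U', z ∉ V' := fun z hz hz' =>
    Set.disjoint_left.1 hO (hU'O hz).1 (hV'O hz').1
  set f := rectangleIndicator U' V' hU' hU'c hV' hV'c with hf
  have hε8 : 0 < ε / 8 := by positivity
  obtain ⟨K, hK, hTK⟩ := (T f).exists_isCompact_abs_lt hε8
  have hnear : ∀ c : L, {z | dist (T f z) (T f c) < ε / 8} ∈ 𝓝 c := fun c =>
    Metric.continuousAt_iff'.1 (map_continuous (T f)).continuousAt _ hε8
  obtain ⟨w, ⟨-, hwζ, x, y, hx, hy, hxR, hyR, hwx, hwy⟩, hw⟩ := hlim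
    (U' ∩ {z | dist (T f z) (T f a) < ε / 8})
    (inter_mem (hU'.isOpen.mem_nhds (haU' rfl)) (hnear a))
    (V' ∩ {z | dist (T f z) (T f b) < ε / 8})
    (inter_mem (hV'.isOpen.mem_nhds (hbV' rfl)) (hnear b))
    (U' ∪ V' ∪ K) ((hU'c.union hV'c).union hK)
  have hlabel : ∀ i, (w i ∈ U' ↔ q i = 0) ∧ (w i ∈ V' ↔ q i = 1) := by
    intro i
    obtain ⟨h0, h1, h2⟩ := hw i
    generalize q i = l at h0 h1 h2
    fin_cases l
    · have := (h0 rfl).1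
      simp [this, hUV' _ this]
    · have := (h1 rfl).1
      have h' : w i ∉ U' := fun h => hUV' _ h this
      simp [this, h']
    · have := h2 rfl
      simp only [Set.mem_union, not_or] at this
      simp [this.1.1, this.1.2]
  have hrootx : ∀ i, (x i ∈ U' ↔ p i = 0) ∧ (x i ∈ V' ↔ p i = 1) := by
    intro i
    by_cases hi : i ∈ R
    · have h1 : x i ∉ U' := fun h => (hU'O h).2.not_ge (hxR i hi)
      have h2 : x i ∉ V' := fun h => (hV'O h).2.not_ge (hxR i hi)
      have h3 : p i ≠ 0 := fun h => hpR i (Or.inl h) hi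
      have h4 : p i ≠ 1 := fun h => hpR i (Or.inr h) hi
      simp [h1, h2, h3, h4]
    · have := hlabel (Sum.inl ⟨i, hi⟩)
      rwa [hwx] at this
  have hrooty : ∀ i, y i ∈ U' ∨ y i ∈ V' → i = i₀ := by
    intro i h
    by_cases hi : i ∈ R
    · rcases h with h | h
      · exact absurd (hyR i hi) (hU'O h).2.not_ge
      · exact absurd (hyR i hi) (hV'O h).2.not_ge
    · by_contra hne
      have hl := hlabel (Sum.inr ⟨i, hi⟩)
      have hq2 : q (Sum.inr ⟨i, hi⟩) = 2 := if_neg hne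
      rw [hwy, hq2] at hl
      rcases h with h | h
      · exact absurd (hl.1.1 h) (by decide)
      · exact absurd (hl.2.1 h) (by decide)
  -- The indicators of `U × V` and `U' × V'` agree at all pairs `(x i, x j)`.
  have hTx : ε - ε / 4 < |T f (x i₀)| := by
    obtain ⟨U, V, hU, hUc, hV, hVc, hUV, -, -, hxU, hxV, hlt⟩ := hx.exists_rectangle
    set g := rectangleIndicator U V hU hUc hV hVc with hg
    have h1 := hx.abs_apply_le (g - f) fun i j => by
      have hiff : (x i, x j) ∈ U ×ˢ V ↔ (x i, x j) ∈ U' ×ˢ V' := by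
        simp only [Set.mem_prod, hxU, hxV, hrootx]
      rw [ZeroAtInftyContinuousMap.sub_apply, sub_eq_zero]
      by_cases hm : (x i, x j) ∈ U ×ˢ V
      · exact (compactIndicator_of_mem _ _ hm).trans
          (compactIndicator_of_mem _ _ (hiff.1 hm)).symm
      · exact (compactIndicator_of_notMem _ _ hm).trans
          (compactIndicator_of_notMem _ _ (hm ∘ hiff.2)).symm
    have h2 : ‖g - f‖ ≤ 1 := norm_compactIndicator_sub_le _ _ _ _
    rw [map_sub, ZeroAtInftyContinuousMap.sub_apply] at h1
    have h3 := abs_sub_abs_le_abs_sub (T g (x i₀)) (T f (x i₀))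
    nlinarith
  -- Only `y i₀` can meet `U' ∪ V'`, and disjointness keeps `(y i₀, y i₀)` out of `U' × V'`.
  have hTy : |T f (y i₀)| ≤ ε / 4 := by
    have h1 := hy.abs_apply_le f fun i j => compactIndicator_of_notMem _ _ fun hm => by
      have hi := hrooty i (Or.inl hm.1)
      have hj := hrooty j (Or.inr hm.2)
      subst hi
      rw [hj] at hm
      exact hUV' _ hm.1 hm.2
    have h2 : ‖f‖ ≤ 1 := norm_compactIndicator_le _ _
    nlinarith
  have hclose : |T f (x i₀) - T f (y i₀)| < ε / 4 := by
    have h1 := hw (Sum.inl ⟨i₀, hi₀R⟩)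
    have h2 := hw (Sum.inr ⟨i₀, hi₀R⟩)
    have hq1 : q (Sum.inl ⟨i₀, hi₀R⟩) = p i₀ := rfl
    have hq2 : q (Sum.inr ⟨i₀, hi₀R⟩) = p i₀ := if_pos rfl
    rw [hwx, hq1] at h1
    rw [hwy, hq2] at h2
    have htri : ∀ c : ℝ, dist (T f (x i₀)) c < ε / 8 → dist (T f (y i₀)) c < ε / 8 →
        |T f (x i₀) - T f (y i₀)| < ε / 4 := by
      intro c hc hc'
      have := dist_triangle_right (T f (x i₀)) (T f (y i₀)) c
      rw [Real.dist_eq] at this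
      linarith
    generalize p i₀ = l at h1 h2
    fin_cases l
    · exact htri _ (h1.1 rfl).2 (h2.1 rfl).2
    · exact htri _ (h1.2.1 rfl).2 (h2.2.1 rfl).2
    · refine htri 0 ?_ ?_ <;> rw [Real.dist_eq, sub_zero]
      · exact hTK _ fun h => h1.2.2 rfl (Or.inr h)
      · exact hTK _ fun h => h2.2.2 rfl (Or.inr h)
  -- The values differ by more than `3ε/4 - ε/4 = ε/2`, yet by less than `ε/4`.
  have := abs_sub_abs_le_abs_sub (T f (x i₀)) (T f (y i₀))
  linarith

/-- An operator on `C₀(L × L)` with values in `C₀(L)` annihilates the rectangles with disjoint sides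
beyond some countable ordinal. -/
theorem exists_forall_rectangleIndicator_eq_zero (hφ : IsFiniteToOneOntoOmegaOne φ)
    (hL : CollapsingProperty L) (T : C₀(L × L, ℝ) →L[ℝ] C₀(L, ℝ)) :
    ∃ β < ω_ 1, ∀ (U V : Set L) (hU : IsClopen U) (hUc : IsCompact U) (hV : IsClopen V)
      (hVc : IsCompact V), Disjoint U V → (∀ z ∈ U, β < φ z) → (∀ z ∈ V, β < φ z) →
        T (rectangleIndicator U V hU hUc hV hVc) = 0 := by
  by_contra! hcon
  obtain ⟨ε, hε, n, p, i₀, hex⟩ := hφ.exists_isRectangleWitness T hcon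
  exact hφ.not_forall_exists_isRectangleWitness hL T hε p i₀ hex

/-! ### Operators into `C₀(M × L)` and the main theorem -/

/-- For countable `M`, every operator on `C₀(L × L)` with values in `C₀(M × L)` annihilates some
function `f` such that, at some point off the diagonal, `f` takes the value `1` and its transpose
vanishes. -/
theorem exists_apply_eq_zero (hφ : IsFiniteToOneOntoOmegaOne φ) (hL : CollapsingProperty L)
    {M : Type*} [TopologicalSpace M] [T1Space M] [Countable M]
    (T : C₀(L × L, ℝ) →L[ℝ] C₀(M × L, ℝ)) :
    ∃ f : C₀(L × L, ℝ), T f = 0 ∧ ∃ u v : L, f (u, v) = 1 ∧ f (v, u) = 0 := by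
  have := hφ.totallyDisconnectedSpace
  have he : ∀ x : M, IsClosedEmbedding fun y : L => (x, y) := fun x =>
    ⟨isEmbedding_prodMkRight x, by
      have : Set.range (fun y : L => (x, y)) = Prod.fst ⁻¹' {x} := by
        ext ⟨z, w⟩; simp [eq_comm]
      rw [this]
      exact isClosed_singleton.preimage continuous_fst⟩
  choose β hβ hβT using fun x : M =>
    hφ.exists_forall_rectangleIndicator_eq_zero hL ((restrictOp _ (he x)).comp T)
  obtain ⟨γ, hγ, hβγ⟩ := exists_lt_omega_one_forall_le β hβ
  have hmem : ∀ δ < ω_ 1, ∃ u, φ u = δ := fun δ hδ => by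
    have : δ ∈ Set.range φ := hφ.range_eq.symm ▸ hδ
    exact this
  have hγ1 := omega_one_succ_lt hγ
  obtain ⟨u, hu⟩ := hmem _ hγ1
  obtain ⟨v, hv⟩ := hmem _ (omega_one_succ_lt hγ1)
  have hγu : γ < φ u := hu ▸ Order.lt_succ γ
  have huv' : φ u < φ v := hv ▸ hu ▸ Order.lt_succ _
  have huv : u ≠ v := fun h => huv'.ne (congrArg φ h)
  obtain ⟨O₁, O₂, hO₁, hO₂, huO, hvO, hO⟩ := t2_separation huv
  obtain ⟨U, hU, hUc, huU, hUO⟩ := exists_isClopen_isCompact_superset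
    (isCompact_singleton (x := u)) (hO₁.inter (hφ.isOpen_setOf_lt γ))
    (Set.singleton_subset_iff.2 ⟨huO, hγu⟩)
  obtain ⟨V, hV, hVc, hvV, hVO⟩ := exists_isClopen_isCompact_superset
    (isCompact_singleton (x := v)) (hO₂.inter (hφ.isOpen_setOf_lt γ))
    (Set.singleton_subset_iff.2 ⟨hvO, hγu.trans huv'⟩)
  have hUV : Disjoint U V := hO.mono (fun z hz => (hUO hz).1) fun z hz => (hVO hz).1
  refine ⟨rectangleIndicator U V hU hUc hV hVc, ?_, u, v,
    compactIndicator_of_mem _ _ ⟨huU rfl, hvV rfl⟩, compactIndicator_of_notMem _ _ fun h =>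
      Set.disjoint_left.1 hUV (huU rfl) h.2⟩
  ext ⟨x, y⟩
  have := hβT x U V hU hUc hV hVc hUV (fun z hz => (hβγ x).trans_lt (hUO hz).2)
    fun z hz => (hβγ x).trans_lt (hVO hz).2
  exact DFunLike.congr_fun this y

/-- For countable `M`, no space isomorphic to `C₀(L × L)`, or to its subspace of symmetric or of
antisymmetric functions, admits an injective bounded operator into `C₀(M × L)`. -/
theorem not_exists_injective (hφ : IsFiniteToOneOntoOmegaOne φ) (hL : CollapsingProperty L)
    {M : Type*} [TopologicalSpace M] [T1Space M] [Countable M]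
    {X : Type*} [NormedAddCommGroup X] [NormedSpace ℝ X]
    (hX : Nonempty (X ≃L[ℝ] C₀(L × L, ℝ)) ∨
      Nonempty (X ≃L[ℝ] LinearMap.range (symmProj L : C₀(L × L, ℝ) →ₗ[ℝ] C₀(L × L, ℝ))) ∨
      Nonempty (X ≃L[ℝ] LinearMap.range (antisymmProj L : C₀(L × L, ℝ) →ₗ[ℝ] C₀(L × L, ℝ)))) :
    ¬ ∃ T : X →L[ℝ] C₀(M × L, ℝ), Function.Injective T := by
  rintro ⟨T, hT⟩
  -- The operator `T ∘ e⁻¹ ∘ P` kills some `f`; injectivity of `T` and `e⁻¹` gives `P f = 0`.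
  have hrange : ∀ P : C₀(L × L, ℝ) →L[ℝ] C₀(L × L, ℝ),
      (X ≃L[ℝ] LinearMap.range (P : C₀(L × L, ℝ) →ₗ[ℝ] C₀(L × L, ℝ))) →
      ∃ f : C₀(L × L, ℝ), P f = 0 ∧ ∃ u v : L, f (u, v) = 1 ∧ f (v, u) = 0 := by
    intro P e
    obtain ⟨f, hf, huv⟩ := hφ.exists_apply_eq_zero hL
      (T.comp ((e.symm : _ →L[ℝ] X).comp (P.codRestrict
        (LinearMap.range (P : C₀(L × L, ℝ) →ₗ[ℝ] C₀(L × L, ℝ))) fun g => ⟨g, rfl⟩)))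
    refine ⟨f, ?_, huv⟩
    have h1 := e.symm.injective ((hT (hf.trans (map_zero T).symm)).trans (map_zero e.symm).symm)
    exact congrArg Subtype.val h1
  rcases hX with ⟨⟨e⟩⟩ | ⟨⟨e⟩⟩ | ⟨⟨e⟩⟩
  · obtain ⟨f, hf, u, v, huv, -⟩ := hφ.exists_apply_eq_zero hL (T.comp (e.symm : _ →L[ℝ] X))
    have h1 : f = 0 :=
      e.symm.injective ((hT (hf.trans (map_zero T).symm)).trans (map_zero e.symm).symm)
    simp [h1] at huv
  · obtain ⟨f, hf, u, v, huv, hvu⟩ := hrange _ e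
    have h1 : (1 / 2 : ℝ) * (f (u, v) + f (v, u)) = 0 := DFunLike.congr_fun hf (u, v)
    norm_num [huv, hvu] at h1
  · obtain ⟨f, hf, u, v, huv, hvu⟩ := hrange _ e
    have h1 : (1 / 2 : ℝ) * (f (u, v) - f (v, u)) = 0 := DFunLike.congr_fun hf (u, v)
    norm_num [huv, hvu] at h1

end IsFiniteToOneOntoOmegaOne

end Operators

theorem proposition6p3 {L : Type*} [TopologicalSpace L] [T2Space L] [LocallyCompactSpace L]
    (φ : L → Ordinal.{0}) (hφ : IsFiniteToOneOntoOmegaOne φ) (hL : CollapsingProperty L)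
    {X : Type*} [NormedAddCommGroup X] [NormedSpace ℝ X]
    (hX : Nonempty (X ≃L[ℝ] C₀(L × L, ℝ)) ∨
      Nonempty (X ≃L[ℝ] LinearMap.range (symmProj L : C₀(L × L, ℝ) →ₗ[ℝ] C₀(L × L, ℝ))) ∨
      Nonempty (X ≃L[ℝ] LinearMap.range (antisymmProj L : C₀(L × L, ℝ) →ₗ[ℝ] C₀(L × L, ℝ)))) :
    (∀ α : Ordinal.{0}, α < ω_ 1 →
      ¬ ∃ T : X →L[ℝ] C₀(initialPart φ α × L, ℝ), Function.Injective T) ∧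
    ¬ ∃ Y : Submodule ℝ C₀(Set.Iio (ω ^ ω : Ordinal.{0}) × L, ℝ), Nonempty (X ≃L[ℝ] Y) := by
  refine ⟨fun α hα => ?_, ?_⟩
  · have := (hφ.countable_initialPart hα).to_subtype
    exact hφ.not_exists_injective hL hX
  · rintro ⟨Y, ⟨e⟩⟩
    -- `ω₁` is closed under ordinal powers.
    have hωω : (ω ^ ω : Ordinal.{0}) < ω_ 1 :=
      Ordinal.isPrincipal_opow_omega 1 Ordinal.omega0_lt_omega_one Ordinal.omega0_lt_omega_one
    have := (countable_Iio_of_lt_omega_one hωω).to_subtype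
    exact hφ.not_exists_injective hL hX
      ⟨Y.subtypeL.comp (e : X →L[ℝ] Y), Subtype.val_injective.comp e.injective⟩
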